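/- Let $X$ be a complex Banach space, let $T$ be a bounded linear operator on $X$, and let $\beta\ge 1$ be a real number. For $\alpha\ge 0$ put $k^{\alpha}(0)=1$, $k^{\alpha}(n)=\frac{\alpha(\alpha+1)\cdots(\alpha+n-1)}{n!}$ for $n\ge 1$, and let $$M_T^{\alpha}(n)=\frac{1}{k^{\alpha+1}(n)}\sum_{j=0}^{n}k^{\alpha}(n-j)\,T^{j},\qquad n=0,1,2,\dots,$$ be the Cesàro means of $T$ of order $\alpha$. The operator $T$ is called $(C,\alpha)$-bounded if $\sup_{n\ge 0}\|M_T^{\alpha}(n)\|<\infty$, and $(C,\alpha)$-ergodic if $\lim_{n\to\infty}M_T^{\alpha}(n)x$ exists in the norm of $X$ for every $x\in X$. Theorem 3.5. Suppose that the spectrum of $T$ satisfies $\sigma(T)\subset\mathbb{D}\cup\{1\}$, where $\mathbb{D}=\{z\in\mathbb{C}:|z|<1\}$. Then $T$ is $(C,\beta)$-ergodic if and only if $T$ is $(C,\beta)$-bounded and $$X=\operatorname{Ker}(I-T)\oplus\overline{\operatorname{Ran}(I-T)}.$$ -/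

import Mathlib

open Filter Topology

/-- The Cesàro numbers `k^α(n) = α (α + 1) ⋯ (α + n - 1) / n!`, with `k^α(0) = 1`. -/
noncomputable def cesaroNumber (α : ℝ) (n : ℕ) : ℝ :=
  (∏ i ∈ Finset.range n, (α + i)) / (n.factorial : ℝ)

section Cesaro

variable {X : Type*} [NormedAddCommGroup X] [NormedSpace ℂ X]

/-- The `n`-th Cesàro sum of order `α` of `T`: `∑_{j=0}^n k^α(n-j) T^j`. -/
noncomputable def cesaroSum (T : X →L[ℂ] X) (α : ℝ) (n : ℕ) : X →L[ℂ] X :=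
  ∑ j ∈ Finset.range (n + 1), ((cesaroNumber α (n - j) : ℝ) : ℂ) • T ^ j

/-- The `n`-th Cesàro mean of order `α` of `T`: the Cesàro sum divided by `k^{α+1}(n)`
(which is positive for `α ≥ 0`). -/
noncomputable def cesaroMean (T : X →L[ℂ] X) (α : ℝ) (n : ℕ) : X →L[ℂ] X :=
  ((cesaroNumber (α + 1) n : ℝ) : ℂ)⁻¹ • cesaroSum T α n

/-- `T` is `(C,α)`-bounded: the operator norms of its Cesàro means of order `α` are bounded. -/
def IsCesaroBounded (T : X →L[ℂ] X) (α : ℝ) : Prop :=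
  BddAbove (Set.range fun n : ℕ => ‖cesaroMean T α n‖)

/-- `T` is `(C,α)`-ergodic: its Cesàro means of order `α` converge at every vector, in norm. -/
def IsCesaroErgodic (T : X →L[ℂ] X) (α : ℝ) : Prop :=
  ∀ x : X, ∃ y : X, Tendsto (fun n : ℕ => cesaroMean T α n x) atTop (𝓝 y)

end Cesaro

/-! ### Cesàro means: recursion, fixed vectors, asymptotic shift -/

section Means

variable {X : Type*} [NormedAddCommGroup X] [NormedSpace ℂ X]

/-! Write `M n` for the means. Ergodicity gives boundedness by Banach–Steinhaus; the pointwise limit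
fixes Ker(I - T) and kills the closure of Ran(I - T), which splits X. For the converse, `M n` is the
identity on Ker(I - T), so by density and boundedness it suffices that `M n (I - T) y → 0`. The
recursion `cesaroMean_succ` gives `T M n - M (n+1) → 0` strongly, which reduces this to `M (n+1) y -
M n y → 0`. That is a Katznelson–Tzafriri type statement. Norming functionals and an ultrafilter
limit turn its failure into a bounded bilateral orbit `v (j+1) = v j ∘ T` in the dual with `v 1 y ≠
v 0 y`. With `λ = 1 + 1/w`, the spectral point 1 goes to infinity and the local resolvent of the
orbit becomes an entire function of `w`, because the backward half of the orbit continues it into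
`|λ| < 1`. Its growth forces its derivative `v 0 (T y - y)` at 0 to vanish
(`bilateral_orbit_fixed`), a contradiction. -/

theorem cesaroNumber_succ_left (β : ℝ) (n : ℕ) :
    cesaroNumber β (n + 1) * (n + 1) = β * cesaroNumber (β + 1) n := by
  have hn : ((n.factorial : ℕ) : ℝ) ≠ 0 := by positivity
  have hn' : ((n : ℝ) + 1) ≠ 0 := by positivity
  unfold cesaroNumber
  rw [Finset.prod_range_succ', Nat.factorial_succ]
  have : ∏ k ∈ Finset.range n, (β + ((k + 1 : ℕ) : ℝ)) = ∏ k ∈ Finset.range n, (β + 1 + k) :=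
    Finset.prod_congr rfl fun k _ => by push_cast; ring
  rw [this]
  push_cast
  field_simp
  ring

theorem cesaroNumber_succ (β : ℝ) (n : ℕ) :
    cesaroNumber β (n + 1) * (n + 1) = (β + n) * cesaroNumber β n := by
  have hn : ((n.factorial : ℕ) : ℝ) ≠ 0 := by positivity
  have hn' : ((n : ℝ) + 1) ≠ 0 := by positivity
  unfold cesaroNumber
  rw [Finset.prod_range_succ, Nat.factorial_succ]
  push_cast
  field_simp

theorem cesaroNumber_pos {β : ℝ} (hβ : 0 < β) (n : ℕ) : 0 < cesaroNumber β n := by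
  unfold cesaroNumber
  have : 0 < ∏ i ∈ Finset.range n, (β + i) := Finset.prod_pos fun i _ => by positivity
  positivity

theorem cesaroNumber_zero (β : ℝ) : cesaroNumber β 0 = 1 := by simp [cesaroNumber]

theorem cesaroSum_succ (T : X →L[ℂ] X) (β : ℝ) (n : ℕ) :
    cesaroSum T β (n + 1) = T * cesaroSum T β n + ((cesaroNumber β (n + 1) : ℝ) : ℂ) • 1 := by
  unfold cesaroSum
  rw [Finset.sum_range_succ', Finset.mul_sum]
  congr 1
  · refine Finset.sum_congr rfl fun j _ => ?_
    rw [Nat.add_sub_add_right, mul_smul_comm, pow_succ']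

theorem cesaroMean_zero (T : X →L[ℂ] X) (β : ℝ) : cesaroMean T β 0 = 1 := by
  simp [cesaroMean, cesaroSum, cesaroNumber_zero]

theorem commute_cesaroMean (T : X →L[ℂ] X) (β : ℝ) (n : ℕ) : Commute T (cesaroMean T β n) := by
  unfold cesaroMean cesaroSum
  exact (Commute.sum_right _ _ _ fun j _ =>
    ((Commute.refl T).pow_right j).smul_right _).smul_right _

/-- Divide `cesaroSum_succ` by `k^{β+1}(n)`, using `k^{β+1}(n+1) / k^{β+1}(n) = 1 + β/(n+1)` and
`k^β(n+1) / k^{β+1}(n) = β/(n+1)`. -/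
theorem cesaroMean_succ (T : X →L[ℂ] X) {β : ℝ} (hβ : 0 ≤ β) (n : ℕ) :
    (1 + (β : ℂ) / (n + 1)) • cesaroMean T β (n + 1)
      = T * cesaroMean T β n + ((β : ℂ) / (n + 1)) • 1 := by
  have h0 : ((cesaroNumber (β + 1) n : ℝ) : ℂ) ≠ 0 := by
    exact_mod_cast (cesaroNumber_pos (by linarith) n).ne'
  have h1 : ((cesaroNumber (β + 1) (n + 1) : ℝ) : ℂ) ≠ 0 := by
    exact_mod_cast (cesaroNumber_pos (by linarith) (n + 1)).ne'
  have hn : ((n : ℂ) + 1) ≠ 0 := by exact_mod_cast n.succ_ne_zero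
  have e1 : ((cesaroNumber (β + 1) (n + 1) : ℝ) : ℂ) * (n + 1)
      = (β + 1 + n) * ((cesaroNumber (β + 1) n : ℝ) : ℂ) := by
    exact_mod_cast cesaroNumber_succ (β + 1) n
  have e2 : ((cesaroNumber β (n + 1) : ℝ) : ℂ) * (n + 1)
      = β * ((cesaroNumber (β + 1) n : ℝ) : ℂ) := by
    exact_mod_cast cesaroNumber_succ_left β n
  unfold cesaroMean
  rw [cesaroSum_succ, smul_add, smul_add, mul_smul_comm, smul_smul, smul_smul, smul_smul]
  have a1 : (1 + (β : ℂ) / (n + 1)) * ((cesaroNumber (β + 1) (n + 1) : ℝ) : ℂ)⁻¹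
      = ((cesaroNumber (β + 1) n : ℝ) : ℂ)⁻¹ := by
    field_simp
    linear_combination -e1
  rw [a1]
  congr 2
  field_simp
  linear_combination e2

theorem cesaroMean_apply_of_fixed {T : X →L[ℂ] X} {β : ℝ} (hβ : 0 ≤ β) {x : X} (hx : T x = x)
    (n : ℕ) : cesaroMean T β n x = x := by
  induction n with
  | zero => simp [cesaroMean_zero]
  | succ n ih =>
    have h := congrArg (fun A : X →L[ℂ] X => A x) (cesaroMean_succ T hβ n)
    have hc : (1 + (β : ℂ) / (n + 1)) ≠ 0 := by
      have : (0 : ℝ) < 1 + β / (n + 1) := by positivity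
      exact_mod_cast this.ne'
    simp only [smul_apply, add_apply, mul_apply_eq_comp,
      one_apply_eq_self, ih, hx] at h
    refine smul_right_injective X hc ?_
    simp only [h, add_smul, one_smul]

theorem sub_cesaroMean_apply_mem_range (T : X →L[ℂ] X) {β : ℝ} (hβ : 0 ≤ β) (x : X) (n : ℕ) :
    x - cesaroMean T β n x ∈ LinearMap.range ((1 - T : X →L[ℂ] X) : X →ₗ[ℂ] X) := by
  induction n with
  | zero => simp [cesaroMean_zero]
  | succ n ih =>
    have h := congrArg (fun A : X →L[ℂ] X => A x) (cesaroMean_succ T hβ n)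
    have hc : (1 + (β : ℂ) / (n + 1)) ≠ 0 := by
      have : (0 : ℝ) < 1 + β / (n + 1) := by positivity
      exact_mod_cast this.ne'
    simp only [smul_apply,
      add_apply, mul_apply_eq_comp,
      one_apply_eq_self] at h
    rw [← Submodule.smul_mem_iff _ hc, smul_sub, h]
    have e : (1 + (β : ℂ) / (n + 1)) • x
        - (T (cesaroMean T β n x) + ((β : ℂ) / (n + 1)) • x)
        = (x - cesaroMean T β n x) + (1 - T) (cesaroMean T β n x) := by
      simp only [add_smul, one_smul, sub_apply,
        one_apply_eq_self]
      abel
    rw [e]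
    exact Submodule.add_mem _ ih ⟨cesaroMean T β n x, rfl⟩

/-- By the recursion the difference equals `β/(n+1)` times the bounded vector `M (n+1) x - x`. -/
theorem tendsto_apply_cesaroMean_sub_succ {T : X →L[ℂ] X} {β : ℝ} (hβ : 0 ≤ β) {x : X} {C : ℝ}
    (hC : ∀ n, ‖cesaroMean T β n x‖ ≤ C) :
    Tendsto (fun n => T (cesaroMean T β n x) - cesaroMean T β (n + 1) x) atTop (𝓝 0) := by
  have hc : Tendsto (fun n : ℕ => β / ((n : ℝ) + 1) * (C + ‖x‖)) atTop (𝓝 0) := by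
    simpa using (tendsto_const_div_atTop_nhds_zero_nat β |>.comp (tendsto_add_atTop_nat 1)
      |>.mul_const (C + ‖x‖))
  refine squeeze_zero_norm (fun n => ?_) hc
  have h := congrArg (fun A : X →L[ℂ] X => A x) (cesaroMean_succ T hβ n)
  simp only [smul_apply,
    add_apply, mul_apply_eq_comp,
    one_apply_eq_self, add_smul, one_smul] at h
  have e : T (cesaroMean T β n x) - cesaroMean T β (n + 1) x
      = ((β : ℂ) / (n + 1)) • (cesaroMean T β (n + 1) x - x) := by
    rw [smul_sub, sub_eq_sub_iff_add_eq_add, ← h]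
    abel
  have hn : ‖(β : ℂ) / (n + 1)‖ = β / (n + 1) := by
    have : (0 : ℝ) ≤ β / (n + 1) := by positivity
    rw [← Real.norm_of_nonneg this, ← Complex.norm_real]
    push_cast
    rfl
  rw [e, norm_smul, hn]
  gcongr
  exact (norm_sub_le _ _).trans (by gcongr; exact hC _)

theorem cesaroMean_limit_fixed {T : X →L[ℂ] X} {β : ℝ} (hβ : 0 ≤ β) {x y : X}
    (h : Tendsto (fun n => cesaroMean T β n x) atTop (𝓝 y)) : T y = y := by
  obtain ⟨C, hC⟩ := h.norm.bddAbove_range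
  have h1 := tendsto_apply_cesaroMean_sub_succ (T := T) hβ (x := x) (C := C)
    fun n => hC ⟨n, rfl⟩
  have h2 := ((T.continuous.tendsto y).comp h).sub (h.comp (tendsto_add_atTop_nat 1))
  exact sub_eq_zero.1 (tendsto_nhds_unique h2 h1)

end Means

/-! ### Bounded bilateral orbits and their local resolvent -/

section BilateralOrbit

theorem summable_pow_mul_of_bounded {c : ℕ → ℂ} {K : ℝ} (hc : ∀ n, ‖c n‖ ≤ K) {z : ℂ}
    (hz : ‖z‖ < 1) : Summable fun n => z ^ n * c n := by
  refine Summable.of_norm_bounded ((summable_geometric_of_lt_one (norm_nonneg z) hz).mul_right K)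
    fun n => ?_
  rw [norm_mul, norm_pow]
  gcongr
  exact hc n

theorem norm_tsum_pow_mul_le {c : ℕ → ℂ} {K : ℝ} (hc : ∀ n, ‖c n‖ ≤ K) {z : ℂ} (hz : ‖z‖ < 1) :
    ‖∑' n, z ^ n * c n‖ ≤ K / (1 - ‖z‖) := by
  have h := (hasSum_geometric_of_lt_one (norm_nonneg z) hz).mul_right K
  rw [div_eq_inv_mul]
  refine tsum_of_norm_bounded h fun n => ?_
  rw [norm_mul, norm_pow]
  gcongr
  exact hc n

theorem differentiableAt_tsum_pow_mul {c : ℕ → ℂ} {K : ℝ} (hc : ∀ n, ‖c n‖ ≤ K) {z : ℂ}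
    (hz : ‖z‖ < 1) : DifferentiableAt ℂ (fun z => ∑' n, z ^ n * c n) z := by
  obtain ⟨r, hr, hr1⟩ := exists_between hz
  have h0 : 0 ≤ r := (norm_nonneg z).trans hr.le
  refine (Complex.differentiableOn_tsum_of_summable_norm (U := Metric.ball 0 r)
    ((summable_geometric_of_lt_one h0 hr1).mul_right K) (fun n => by fun_prop) Metric.isOpen_ball
    fun n w hw => ?_).differentiableAt (Metric.isOpen_ball.mem_nhds (by simpa using hr))
  have hw' : ‖w‖ ≤ r := (mem_ball_zero_iff.1 hw).le
  rw [norm_mul, norm_pow]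
  gcongr
  exact hc n

variable {X : Type*} [NormedAddCommGroup X] [NormedSpace ℂ X]

theorem tsum_pow_mul_sub_telescope {c : ℕ → ℂ} {K : ℝ} (hc : ∀ n, ‖c n‖ ≤ K) {z : ℂ} (hz : ‖z‖ < 1) :
    ∑' n, z ^ n * (c n - z * c (n + 1)) = c 0 := by
  have h1 := summable_pow_mul_of_bounded hc hz
  have h2 := (summable_nat_add_iff 1).2 h1
  have : (fun n => z ^ n * (c n - z * c (n + 1)))
      = fun n => z ^ n * c n - z ^ (n + 1) * c (n + 1) := by
    funext n; ring
  rw [this, h1.tsum_sub h2, h1.tsum_eq_zero_add]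
  simp

/-- For `w ≠ 0` the operator is `w (λ - T)` with `λ = 1 + 1/w`; the hypothesis says `|λ| ≥ 1`, and
`λ ≠ 1`. -/
theorem isUnit_one_sub_smul {T : X →L[ℂ] X}
    (hσ : spectrum ℂ T ⊆ Metric.ball (0 : ℂ) 1 ∪ {1}) {w : ℂ} (hw : ‖w‖ ≤ ‖w + 1‖) :
    IsUnit (1 - w • (T - 1)) := by
  rcases eq_or_ne w 0 with rfl | h0
  · simp
  have hmem : (1 + w⁻¹) ∉ spectrum ℂ T := fun h => by
    rcases hσ h with h | h
    · have h' : ‖(w + 1) * w⁻¹‖ < 1 := by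
        rw [add_mul, mul_inv_cancel₀ h0, one_mul]; simpa using h
      rw [norm_mul, norm_inv, ← div_eq_mul_inv, div_lt_one (norm_pos_iff.2 h0)] at h'
      linarith
    · simp [h0] at h
  have hu := spectrum.notMem_iff.1 hmem
  have e : 1 - w • (T - 1) = w • (algebraMap ℂ (X →L[ℂ] X) (1 + w⁻¹) - T) := by
    rw [Algebra.algebraMap_eq_smul_one, smul_sub, smul_sub, smul_smul, mul_add,
      mul_inv_cancel₀ h0, mul_one, add_smul, one_smul]
    abel
  rw [e]
  exact hu.smul (Units.mk0 w h0)

variable {v : ℤ → StrongDual ℂ X} {C : ℝ} {T : X →L[ℂ] X}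

/-- Neumann series of `(w + 1)(1 - zT)` with `z = w/(w+1)`, tested against `v 0`; it converges
because the forward orbit is bounded, and it telescopes. -/
theorem eq_tsum_of_norm_lt (hC : ∀ j, ‖v j‖ ≤ C) (hv : ∀ j x, v (j + 1) x = v j (T x))
    {w : ℂ} (hw : ‖w‖ < ‖w + 1‖) (x : X) :
    v 0 x = (w + 1)⁻¹ * ∑' n : ℕ, (w / (w + 1)) ^ n * v n (x - w • (T x - x)) := by
  have h1 : 0 < ‖w + 1‖ := (norm_nonneg w).trans_lt hw
  have h0 : w + 1 ≠ 0 := norm_pos_iff.1 h1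
  have hz : ‖w / (w + 1)‖ < 1 := by rwa [norm_div, div_lt_one h1]
  have hb : ∀ n : ℕ, ‖v (n : ℤ) x‖ ≤ C * ‖x‖ := fun n => (v n).le_of_opNorm_le (hC n) x
  have h := tsum_pow_mul_sub_telescope (c := fun n : ℕ => v n x) hb hz
  have e : ∀ n : ℕ, (w / (w + 1)) ^ n * v n (x - w • (T x - x))
      = (w + 1) * ((w / (w + 1)) ^ n * (v n x - w / (w + 1) * v ((n + 1 : ℕ) : ℤ) x)) := by
    intro n
    rw [Nat.cast_succ, hv, map_sub, map_smul, map_sub, smul_eq_mul]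
    field_simp
    ring
  simp only [e]
  rw [tsum_mul_left, h, inv_mul_cancel_left₀ h0]
  rfl

/-- The expansion of `-w (T - λ)` in negative powers of `T`, with `v (-n - 1)` standing in for `v 0
∘ T^(-n-1)`; `T` need not be invertible. -/
theorem eq_tsum_of_lt_norm (hC : ∀ j, ‖v j‖ ≤ C) (hv : ∀ j x, v (j + 1) x = v j (T x))
    {w : ℂ} (hw : ‖w + 1‖ < ‖w‖) (x : X) :
    v 0 x = -w⁻¹ * ∑' n : ℕ, ((w + 1) / w) ^ n * v (-n - 1) (x - w • (T x - x)) := by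
  have h1 : 0 < ‖w‖ := (norm_nonneg _).trans_lt hw
  have h0 : w ≠ 0 := norm_pos_iff.1 h1
  have hz : ‖(w + 1) / w‖ < 1 := by rwa [norm_div, div_lt_one h1]
  have hb : ∀ n : ℕ, ‖v (-n : ℤ) x‖ ≤ C * ‖x‖ := fun n => (v _).le_of_opNorm_le (hC _) x
  have h := tsum_pow_mul_sub_telescope (c := fun n : ℕ => v (-n) x) hb hz
  have e : ∀ n : ℕ, ((w + 1) / w) ^ n * v (-n - 1) (x - w • (T x - x))
      = -w * (((w + 1) / w) ^ n * (v (-n) x - (w + 1) / w * v (-((n + 1 : ℕ) : ℤ)) x)) := by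
    intro n
    have h2 := hv (-n - 1) x
    rw [sub_add_cancel] at h2
    rw [map_sub, map_smul, map_sub, ← h2, smul_eq_mul, Nat.cast_succ, neg_add']
    field_simp
    ring
  simp only [e]
  rw [tsum_mul_left, h]
  simp [h0]

open Classical in
/-- The local resolvent `w ↦ v₀ ((1 - w (T - 1))⁻¹ y)` along a bilateral orbit `v`, extended to
the half plane `‖w + 1‖ < ‖w‖` by the backward half of the orbit. -/
noncomputable def orbitResolvent (v : ℤ → StrongDual ℂ X) (T : X →L[ℂ] X) (y : X) (w : ℂ) : ℂ :=
  if ‖w + 1‖ < ‖w‖ then -w⁻¹ * ∑' n : ℕ, ((w + 1) / w) ^ n * v (-n - 1) y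
  else v 0 (Ring.inverse (1 - w • (T - 1)) y)

theorem ringInverse_solves {w : ℂ} (hu : IsUnit (1 - w • (T - 1))) (y : X) :
    Ring.inverse (1 - w • (T - 1)) y
      - w • (T (Ring.inverse (1 - w • (T - 1)) y) - Ring.inverse (1 - w • (T - 1)) y) = y := by
  simpa using congrArg (fun A : X →L[ℂ] X => A y) (Ring.mul_inverse_cancel _ hu)

/-- The two branches agree wherever both make sense, so the gluing is analytic across the line `‖w +
1‖ = ‖w‖`. -/
theorem orbitResolvent_eq (hC : ∀ j, ‖v j‖ ≤ C) (hv : ∀ j x, v (j + 1) x = v j (T x)) (y : X)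
    {w : ℂ} (hu : IsUnit (1 - w • (T - 1))) :
    orbitResolvent v T y w = v 0 (Ring.inverse (1 - w • (T - 1)) y) := by
  unfold orbitResolvent
  split_ifs with h
  · rw [eq_tsum_of_lt_norm hC hv h (Ring.inverse (1 - w • (T - 1)) y), ringInverse_solves hu]
  · rfl

theorem orbitResolvent_eventuallyEq [CompleteSpace X]
    (hC : ∀ j, ‖v j‖ ≤ C) (hv : ∀ j x, v (j + 1) x = v j (T x)) (y : X)
    {w : ℂ} (hu : IsUnit (1 - w • (T - 1))) :
    orbitResolvent v T y =ᶠ[𝓝 w] fun w => v 0 (Ring.inverse (1 - w • (T - 1)) y) := by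
  have hc : ContinuousAt (fun w : ℂ => 1 - w • (T - 1)) w := by fun_prop
  filter_upwards [hc.preimage_mem_nhds (Units.isOpen.mem_nhds hu)] with z hz
  exact orbitResolvent_eq hC hv y hz

theorem differentiable_orbitResolvent [CompleteSpace X]
    (hσ : spectrum ℂ T ⊆ Metric.ball (0 : ℂ) 1 ∪ {1})
    (hC : ∀ j, ‖v j‖ ≤ C) (hv : ∀ j x, v (j + 1) x = v j (T x)) (y : X) :
    Differentiable ℂ (orbitResolvent v T y) := by
  intro w
  by_cases h : ‖w + 1‖ < ‖w‖
  · have h1 : 0 < ‖w‖ := (norm_nonneg _).trans_lt h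
    have h0 : w ≠ 0 := norm_pos_iff.1 h1
    have hz : ‖(w + 1) / w‖ < 1 := by rwa [norm_div, div_lt_one h1]
    have hb : ∀ n : ℕ, ‖v (-n - 1 : ℤ) y‖ ≤ C * ‖y‖ := fun n => (v _).le_of_opNorm_le (hC _) y
    have hd : DifferentiableAt ℂ
        (fun w : ℂ => -w⁻¹ * ∑' n : ℕ, ((w + 1) / w) ^ n * v (-n - 1) y) w := by
      refine (differentiableAt_inv h0).neg.mul ?_
      exact (differentiableAt_tsum_pow_mul hb hz).comp w
        (f := fun w : ℂ => (w + 1) / w) (by fun_prop (disch := exact h0))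
    refine hd.congr_of_eventuallyEq ?_
    have ho : IsOpen {w : ℂ | ‖w + 1‖ < ‖w‖} := isOpen_lt (by fun_prop) (by fun_prop)
    filter_upwards [ho.mem_nhds h] with z hz
    exact if_pos hz
  · have hu := isUnit_one_sub_smul hσ (not_lt.1 h)
    refine DifferentiableAt.congr_of_eventuallyEq ?_ (orbitResolvent_eventuallyEq hC hv y hu)
    have hi : DifferentiableAt ℂ (fun w : ℂ => Ring.inverse (1 - w • (T - 1))) w :=
      (differentiableAt_inverse hu).comp w (f := fun w : ℂ => 1 - w • (T - 1)) (by fun_prop)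
    exact (v 0).differentiableAt.comp w (hi.clm_apply (differentiableAt_const y))

theorem hasDerivAt_inverse_one_sub_smul_zero {A : Type*} [NormedRing A] [NormedAlgebra ℂ A]
    [CompleteSpace A] (a : A) :
    HasDerivAt (fun w : ℂ => Ring.inverse (1 - w • a)) a 0 := by
  have hl : HasDerivAt (fun w : ℂ => 1 - w • a) (-a) 0 := by
    simpa using ((hasDerivAt_id (0 : ℂ)).smul_const a).const_sub 1
  have hi := (hasFDerivAt_ringInverse (𝕜 := ℂ) (1 : Aˣ)).comp_hasDerivAt_of_eq (0 : ℂ) hl (by simp)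
  exact hi.congr_deriv (by simp)

theorem hasDerivAt_orbitResolvent_zero [CompleteSpace X]
    (hC : ∀ j, ‖v j‖ ≤ C) (hv : ∀ j x, v (j + 1) x = v j (T x)) (y : X) :
    HasDerivAt (orbitResolvent v T y) (v 0 (T y - y)) 0 := by
  have hu : IsUnit (1 - (0 : ℂ) • (T - 1)) := by simp
  refine HasDerivAt.congr_of_eventuallyEq ?_ (orbitResolvent_eventuallyEq hC hv y hu)
  have h := (hasDerivAt_inverse_one_sub_smul_zero (T - 1)).clm_apply (hasDerivAt_const (0 : ℂ) y)
  exact ((v 0).hasFDerivAt.comp_hasDerivAt (0 : ℂ) h).congr_deriv (by simp)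

/-- On either side of the critical line a geometric series gives the bound `C‖y‖ / |‖w + 1‖ - ‖w‖|`.
Clearing denominators includes the line itself and matches `norm_quadratic_of_norm_eq`. -/
theorem norm_orbitResolvent_mul_le
    (hσ : spectrum ℂ T ⊆ Metric.ball (0 : ℂ) 1 ∪ {1})
    (hC : ∀ j, ‖v j‖ ≤ C) (hv : ∀ j x, v (j + 1) x = v j (T x)) (y : X) (w : ℂ) :
    ‖orbitResolvent v T y w‖ * |‖w + 1‖ ^ 2 - ‖w‖ ^ 2| ≤ C * ‖y‖ * (‖w + 1‖ + ‖w‖) := by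
  have hC0 : 0 ≤ C := (norm_nonneg _).trans (hC 0)
  have hb : ∀ j, ‖v j y‖ ≤ C * ‖y‖ := fun j => (v _).le_of_opNorm_le (hC _) y
  have hfac : |‖w + 1‖ ^ 2 - ‖w‖ ^ 2| = |‖w + 1‖ - ‖w‖| * (‖w + 1‖ + ‖w‖) := by
    rw [sq_sub_sq, abs_mul, abs_of_nonneg (by positivity : 0 ≤ ‖w + 1‖ + ‖w‖), mul_comm]
  rw [hfac, ← mul_assoc]
  refine mul_le_mul_of_nonneg_right ?_ (by positivity)
  rcases lt_trichotomy ‖w + 1‖ ‖w‖ with h | h | h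
  · have h1 : 0 < ‖w‖ := (norm_nonneg _).trans_lt h
    have hz : ‖(w + 1) / w‖ < 1 := by rwa [norm_div, div_lt_one h1]
    have := norm_tsum_pow_mul_le (fun n : ℕ => hb (-n - 1)) hz
    rw [norm_div] at this
    rw [orbitResolvent, if_pos h, norm_mul, norm_neg, norm_inv, abs_of_neg (sub_neg.2 h)]
    calc _ ≤ ‖w‖⁻¹ * (C * ‖y‖ / (1 - ‖w + 1‖ / ‖w‖)) * -(‖w + 1‖ - ‖w‖) := by
          gcongr; linarith
      _ = C * ‖y‖ := by
          have : ‖w‖ - ‖w + 1‖ ≠ 0 := by linarith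
          field_simp
          ring
  · rw [h, sub_self, abs_zero, mul_zero]; positivity
  · have h1 : 0 < ‖w + 1‖ := (norm_nonneg _).trans_lt h
    have hz : ‖w / (w + 1)‖ < 1 := by rwa [norm_div, div_lt_one h1]
    have := norm_tsum_pow_mul_le (fun n : ℕ => hb n) hz
    rw [norm_div] at this
    have hu := isUnit_one_sub_smul hσ h.le
    rw [orbitResolvent_eq hC hv y hu, eq_tsum_of_norm_lt hC hv h, ringInverse_solves hu,
      norm_mul, norm_inv, abs_of_pos (sub_pos.2 h)]
    calc _ ≤ ‖w + 1‖⁻¹ * (C * ‖y‖ / (1 - ‖w‖ / ‖w + 1‖)) * (‖w + 1‖ - ‖w‖) := by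
          gcongr
      _ = C * ‖y‖ := by
          have : ‖w + 1‖ - ‖w‖ ≠ 0 := by linarith
          field_simp

/-- On the circle `R² = w w̄`, so the quadratic is `w (w + 1 + w̄)`. It vanishes exactly where the
circle meets the critical line, cancelling the blow-up of the resolvent bound. -/
theorem norm_quadratic_of_norm_eq {w : ℂ} {R : ℝ} (hw : ‖w‖ = R) :
    ‖w ^ 2 + w + (R : ℂ) ^ 2‖ = R * |‖w + 1‖ ^ 2 - ‖w‖ ^ 2| := by
  have h1 : (R : ℂ) ^ 2 = w * (starRingEnd ℂ) w := by
    rw [Complex.mul_conj, Complex.normSq_eq_norm_sq, hw]; push_cast; rfl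
  have h2 : w ^ 2 + w + (R : ℂ) ^ 2 = w * ((‖w + 1‖ ^ 2 - ‖w‖ ^ 2 : ℝ) : ℂ) := by
    push_cast
    rw [h1, ← Complex.mul_conj', ← Complex.mul_conj', map_add, map_one]
    ring
  rw [h2, norm_mul, hw, Complex.norm_real, Real.norm_eq_abs]

/-- A bounded bilateral orbit in the dual of an operator with spectrum in `𝔻 ∪ {1}` is constant. -/
theorem bilateral_orbit_fixed [CompleteSpace X]
    (hσ : spectrum ℂ T ⊆ Metric.ball (0 : ℂ) 1 ∪ {1})
    (hC : ∀ j, ‖v j‖ ≤ C) (hv : ∀ j x, v (j + 1) x = v j (T x)) (y : X) :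
    v 0 (T y) = v 0 y := by
  have hC0 : 0 ≤ C := (norm_nonneg _).trans (hC 0)
  -- Cauchy's estimate at 0 for the resolvent times the quadratic, which is `O(R²)` on the circle;
  -- the 3 comes from `‖w + 1‖ + ‖w‖ ≤ 2R + 1 ≤ 3R`. Dividing by `R²` then kills the leading
  -- coefficient.
  have key : ∀ R : ℝ, 1 ≤ R → ‖v 0 (T y - y) * (R : ℂ) ^ 2 + v 0 y‖ ≤ 3 * (C * ‖y‖) * R := by
    intro R hR
    have hR0 : 0 < R := by linarith
    have hd : Differentiable ℂ fun w => orbitResolvent v T y w * (w ^ 2 + w + (R : ℂ) ^ 2) :=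
      (differentiable_orbitResolvent hσ hC hv y).mul (by fun_prop)
    have hq : HasDerivAt (fun w : ℂ => w ^ 2 + w + (R : ℂ) ^ 2) 1 0 := by
      simpa using (((hasDerivAt_id (0 : ℂ)).pow 2).add (hasDerivAt_id (0 : ℂ))).add_const
        ((R : ℂ) ^ 2)
    have hder := ((hasDerivAt_orbitResolvent_zero hC hv y).mul hq).deriv
    have hval : orbitResolvent v T y 0 = v 0 y := by
      rw [orbitResolvent_eq hC hv y (by simp)]; simp
    have hcauchy := Complex.norm_deriv_le_of_forall_mem_sphere_norm_le (c := (0 : ℂ))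
      (C := 3 * (C * ‖y‖) * R ^ 2) hR0 hd.diffContOnCl fun w hw => by
        have hw' : ‖w‖ = R := by simpa using hw
        have h1 : ‖w + 1‖ ≤ R + 1 := (norm_add_le _ _).trans (by simp [hw'])
        have hK := norm_orbitResolvent_mul_le hσ hC hv y w
        rw [norm_mul, norm_quadratic_of_norm_eq hw']
        calc _ = R * (‖orbitResolvent v T y w‖ * |‖w + 1‖ ^ 2 - ‖w‖ ^ 2|) := by ring
          _ ≤ R * (C * ‖y‖ * (3 * R)) := by
            refine mul_le_mul_of_nonneg_left (hK.trans ?_) hR0.le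
            gcongr
            linarith
          _ = _ := by ring
    have e : deriv (fun w => orbitResolvent v T y w * (w ^ 2 + w + (R : ℂ) ^ 2)) 0
        = v 0 (T y - y) * (R : ℂ) ^ 2 + v 0 y := by
      refine hder.trans ?_
      rw [hval]; ring
    rw [e] at hcauchy
    refine hcauchy.trans (le_of_eq ?_)
    field_simp
  have hlim : Tendsto (fun R : ℝ => (3 * (C * ‖y‖) + ‖v 0 y‖) / R) atTop (𝓝 0) :=
    tendsto_const_nhds.div_atTop tendsto_id
  have hle : ‖v 0 (T y - y)‖ ≤ 0 := by
    refine ge_of_tendsto hlim ?_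
    filter_upwards [eventually_ge_atTop 1] with R hR
    have hR0 : 0 < R := by linarith
    rw [le_div_iff₀ hR0]
    have h1 : ‖v 0 (T y - y)‖ * R ^ 2 ≤ 3 * (C * ‖y‖) * R + ‖v 0 y‖ := by
      have := norm_sub_le (v 0 (T y - y) * (R : ℂ) ^ 2 + v 0 y) (v 0 y)
      rw [add_sub_cancel_right, norm_mul, norm_pow, Complex.norm_real,
        Real.norm_of_nonneg hR0.le] at this
      linarith [key R hR]
    have h2 : ‖v 0 y‖ ≤ ‖v 0 y‖ * R := le_mul_of_one_le_right (norm_nonneg _) hR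
    refine le_of_mul_le_mul_right ?_ hR0
    calc _ = ‖v 0 (T y - y)‖ * R ^ 2 := by ring
      _ ≤ _ := by linarith
  rw [← sub_eq_zero, ← map_sub]
  exact norm_le_zero_iff.1 hle

end BilateralOrbit

/-! ### From asymptotic orbits to the ergodic decomposition -/

section Ergodic

variable {X : Type*} [NormedAddCommGroup X] [NormedSpace ℂ X] {T : X →L[ℂ] X}

/-- Compactness of closed discs gives the limits along `U`. Recentring at index `n` makes negative
`j` available; the truncation by `toNat` affects only finitely many `n` for each `j`. -/
theorem exists_bilateral_limit {u : ℕ → X →L[ℂ] X} {C : ℝ} (hu : ∀ n, ‖u n‖ ≤ C)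
    (hT : ∀ x, Tendsto (fun n => u n (T x) - u (n + 1) x) atTop (𝓝 0))
    {φ : ℕ → StrongDual ℂ X} (hφ : ∀ n, ‖φ n‖ ≤ 1) (U : Ultrafilter ℕ) (hU : (U : Filter ℕ) ≤ atTop) :
    ∃ v : ℤ → StrongDual ℂ X, (∀ j, ‖v j‖ ≤ C) ∧ (∀ j x, v (j + 1) x = v j (T x)) ∧
      ∀ j x, Tendsto (fun n : ℕ => φ n (u (n + j : ℤ).toNat x)) U (𝓝 (v j x)) := by
  have hC0 : 0 ≤ C := (norm_nonneg _).trans (hu 0)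
  have hb : ∀ (n m : ℕ) (x : X), ‖φ n (u m x)‖ ≤ C * ‖x‖ := fun n m x =>
    ((φ n).le_of_opNorm_le (hφ n) _).trans (by simpa using (u m).le_of_opNorm_le (hu m) x)
  have hex : ∀ (j : ℤ) (x : X), ∃ l : ℂ, ‖l‖ ≤ C * ‖x‖ ∧
      Tendsto (fun n : ℕ => φ n (u (n + j : ℤ).toNat x)) U (𝓝 l) := by
    intro j x
    obtain ⟨l, hl, hl'⟩ := (isCompact_closedBall (0 : ℂ) (C * ‖x‖)).ultrafilter_le_nhds
      (U.map fun n : ℕ => φ n (u (n + j : ℤ).toNat x)) (by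
        refine tendsto_principal.2 (Eventually.of_forall fun n => ?_)
        simpa using hb n _ x)
    exact ⟨l, by simpa using hl, hl'⟩
  choose l hl hlim using hex
  have hne : (U : Filter ℕ).NeBot := U.neBot
  let V : ℤ → StrongDual ℂ X := fun j => LinearMap.mkContinuous
    { toFun := l j
      map_add' := fun x y => tendsto_nhds_unique (hlim j (x + y)) (by
        simpa using (hlim j x).add (hlim j y))
      map_smul' := fun c x => tendsto_nhds_unique (hlim j (c • x)) (by
        simpa using (hlim j x).const_mul c) } C (hl j)
  refine ⟨V, fun j => LinearMap.mkContinuous_norm_le _ hC0 _, fun j x => ?_, hlim⟩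
  have hto : Tendsto (fun n : ℕ => (n + j : ℤ).toNat) U atTop := by
    refine Tendsto.mono_left ?_ hU
    refine tendsto_atTop.2 fun b => ?_
    filter_upwards [eventually_ge_atTop (b + j.natAbs)] with n hn
    omega
  have hev : ∀ᶠ n : ℕ in (U : Filter ℕ), (n + (j + 1) : ℤ).toNat = (n + j : ℤ).toNat + 1 := by
    refine hU ?_
    filter_upwards [eventually_ge_atTop j.natAbs] with n hn
    omega
  have h0 : Tendsto (fun n : ℕ => φ n (u (n + j : ℤ).toNat (T x))
      - φ n (u (n + (j + 1) : ℤ).toNat x)) U (𝓝 0) := by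
    refine squeeze_zero_norm' ?_ (((hT x).comp hto).norm.trans (by simp))
    filter_upwards [hev] with n hn
    rw [hn, ← map_sub]
    exact ((φ n).le_of_opNorm_le (hφ n) _).trans_eq (one_mul _)
  have h1 := tendsto_nhds_unique ((hlim j (T x)).sub (hlim (j + 1) x)) h0
  exact (sub_eq_zero.1 h1).symm

theorem tendsto_succ_sub_of_asymptotic_orbit [CompleteSpace X]
    (hσ : spectrum ℂ T ⊆ Metric.ball (0 : ℂ) 1 ∪ {1})
    {u : ℕ → X →L[ℂ] X} {C : ℝ} (hu : ∀ n, ‖u n‖ ≤ C)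
    (hT : ∀ x, Tendsto (fun n => u n (T x) - u (n + 1) x) atTop (𝓝 0)) (y : X) :
    Tendsto (fun n => u (n + 1) y - u n y) atTop (𝓝 0) := by
  rw [tendsto_zero_iff_norm_tendsto_zero, tendsto_iff_ultrafilter]
  intro U hU
  -- With norming functionals, `v 1 y - v 0 y` is the limit of the norms themselves along `U`.
  choose φ hφ hφy using fun n => exists_dual_vector'' ℂ (u (n + 1) y - u n y)
  obtain ⟨v, hvC, hv, hlim⟩ := exists_bilateral_limit hu hT hφ U hU
  have h := (hlim 1 y).sub (hlim 0 y)
  have e : v 1 y = v 0 y := by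
    have := hv 0 y
    rw [zero_add] at this
    rw [this, bilateral_orbit_fixed hσ hvC hv]
  rw [e, sub_self] at h
  have h2 := h.norm
  rw [norm_zero] at h2
  refine h2.congr fun n => ?_
  have e1 : (n + 1 : ℤ).toNat = n + 1 := by omega
  have e0 : (n + 0 : ℤ).toNat = n := by omega
  rw [e1, e0, ← map_sub, hφy]
  simp

theorem tendsto_cesaroMean_range [CompleteSpace X]
    (hσ : spectrum ℂ T ⊆ Metric.ball (0 : ℂ) 1 ∪ {1}) {β : ℝ} (hβ : 0 ≤ β) {C : ℝ}
    (hC : ∀ n, ‖cesaroMean T β n‖ ≤ C) (y : X) :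
    Tendsto (fun n => cesaroMean T β n ((1 - T) y)) atTop (𝓝 0) := by
  have hcomm : ∀ n x, cesaroMean T β n (T x) = T (cesaroMean T β n x) := fun n x =>
    (congrArg (fun A : X →L[ℂ] X => A x) (commute_cesaroMean T β n).eq).symm
  have hT : ∀ x, Tendsto (fun n => cesaroMean T β n (T x) - cesaroMean T β (n + 1) x)
      atTop (𝓝 0) := fun x => by
    simp only [hcomm]
    exact tendsto_apply_cesaroMean_sub_succ hβ fun n =>
      (cesaroMean T β n).le_of_opNorm_le (hC n) x
  have h := ((hT y).add (tendsto_succ_sub_of_asymptotic_orbit hσ hC hT y)).neg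
  rw [add_zero, neg_zero] at h
  refine h.congr fun n => ?_
  simp

theorem tendsto_cesaroMean_closure_range [CompleteSpace X]
    (hσ : spectrum ℂ T ⊆ Metric.ball (0 : ℂ) 1 ∪ {1}) {β : ℝ} (hβ : 0 ≤ β) {C : ℝ}
    (hC : ∀ n, ‖cesaroMean T β n‖ ≤ C) {x : X}
    (hx : x ∈ (LinearMap.range ((1 - T : X →L[ℂ] X) : X →ₗ[ℂ] X)).topologicalClosure) :
    Tendsto (fun n => cesaroMean T β n x) atTop (𝓝 0) := by
  have hC0 : 0 ≤ C := (norm_nonneg _).trans (hC 0)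
  rw [Metric.tendsto_atTop]
  intro ε hε
  -- `C + 1` rather than `C`, since `C` may be 0.
  obtain ⟨_, ⟨y, rfl⟩, hy⟩ := Metric.mem_closure_iff.1 hx (ε / (2 * (C + 1))) (by positivity)
  obtain ⟨n₀, hn₀⟩ := Metric.tendsto_atTop.1 (tendsto_cesaroMean_range hσ hβ hC y) (ε / 2)
    (by positivity)
  refine ⟨n₀, fun n hn => ?_⟩
  have h1 := hn₀ n hn
  have h2 : ‖cesaroMean T β n (x - (1 - T) y)‖ ≤ ε / 2 := by
    refine ((cesaroMean T β n).le_of_opNorm_le (hC n) _).trans ?_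
    rw [dist_eq_norm] at hy
    calc C * ‖x - (1 - T) y‖ ≤ (C + 1) * (ε / (2 * (C + 1))) := by
          gcongr
          · linarith
          · exact hy.le
      _ = ε / 2 := by field_simp
  rw [dist_zero_right] at h1 ⊢
  have h3 := norm_add_le (cesaroMean T β n (x - (1 - T) y)) (cesaroMean T β n ((1 - T) y))
  rw [← map_add, sub_add_cancel] at h3
  linarith

theorem IsCesaroErgodic.isCesaroBounded [CompleteSpace X] {β : ℝ} (h : IsCesaroErgodic T β) :
    IsCesaroBounded T β := by
  obtain ⟨C, hC⟩ := banach_steinhaus (g := fun n => cesaroMean T β n) fun x => by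
    obtain ⟨y, hy⟩ := h x
    obtain ⟨C, hC⟩ := hy.norm.bddAbove_range
    exact ⟨C, fun n => hC ⟨n, rfl⟩⟩
  exact ⟨C, by rintro _ ⟨n, rfl⟩; exact hC n⟩

theorem IsCesaroErgodic.isCompl [CompleteSpace X] {β : ℝ} (hβ : 0 ≤ β)
    (h : IsCesaroErgodic T β) :
    IsCompl (LinearMap.ker ((1 - T : X →L[ℂ] X) : X →ₗ[ℂ] X))
      (LinearMap.range ((1 - T : X →L[ℂ] X) : X →ₗ[ℂ] X)).topologicalClosure := by
  have hker : ∀ x, x ∈ LinearMap.ker ((1 - T : X →L[ℂ] X) : X →ₗ[ℂ] X) ↔ T x = x := fun x => by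
    rw [eq_comm, ← sub_eq_zero]
    rfl
  choose p hp using h
  obtain ⟨P, hP⟩ : ∃ P : X →L[ℂ] X, ⇑P = p :=
    ⟨continuousLinearMapOfTendsto (fun n => cesaroMean T β n) (tendsto_pi_nhds.2 hp), rfl⟩
  subst hP
  have hPT : ∀ y, P ((1 - T) y) = 0 := fun y => by
    have h1 : T (P y) = P y := cesaroMean_limit_fixed hβ (hp y)
    have h2 : P (T y) = T (P y) := by
      refine tendsto_nhds_unique (hp (T y)) (((T.continuous.tendsto _).comp (hp y)).congr
        fun n => ?_)
      exact congrArg (fun A : X →L[ℂ] X => A y) (commute_cesaroMean T β n).eq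
    simp [h2, h1]
  constructor
  · rw [Submodule.disjoint_def]
    intro x hx hx'
    have hfix := (hker x).1 hx
    have h1 : P x = x := tendsto_nhds_unique (hp x) (by
      simp only [cesaroMean_apply_of_fixed hβ hfix]; exact tendsto_const_nhds)
    have h2 : (LinearMap.range ((1 - T : X →L[ℂ] X) : X →ₗ[ℂ] X)).topologicalClosure
        ≤ LinearMap.ker (P : X →ₗ[ℂ] X) := by
      refine Submodule.topologicalClosure_minimal _ ?_ P.isClosed_ker
      rintro _ ⟨y, rfl⟩
      exact hPT y
    rw [← h1]
    exact h2 hx'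
  · rw [codisjoint_iff, eq_top_iff]
    intro x _
    -- `x - P x` is the limit of `x - M n x`, each of which lies in the range of `1 - T`.
    refine Submodule.mem_sup.2 ⟨P x, (hker _).2 (cesaroMean_limit_fixed hβ (hp x)), x - P x, ?_,
      by abel⟩
    exact mem_closure_of_tendsto (tendsto_const_nhds.sub (hp x))
      (Eventually.of_forall fun n => sub_cesaroMean_apply_mem_range T hβ x n)

end Ergodic

theorem theorem3p5 {X : Type*} [NormedAddCommGroup X] [NormedSpace ℂ X] [CompleteSpace X]
    (β : ℝ) (hβ : 1 ≤ β) (T : X →L[ℂ] X)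
    (hσ : spectrum ℂ T ⊆ Metric.ball (0 : ℂ) 1 ∪ {1}) :
    IsCesaroErgodic T β ↔
      IsCesaroBounded T β ∧
        IsCompl (LinearMap.ker ((1 - T : X →L[ℂ] X) : X →ₗ[ℂ] X))
          (LinearMap.range ((1 - T : X →L[ℂ] X) : X →ₗ[ℂ] X)).topologicalClosure := by
  have hβ0 : 0 ≤ β := by linarith
  refine ⟨fun h => ⟨h.isCesaroBounded, h.isCompl hβ0⟩, ?_⟩
  rintro ⟨⟨C, hC⟩, hcompl⟩ x
  have hC' : ∀ n, ‖cesaroMean T β n‖ ≤ C := fun n => hC ⟨n, rfl⟩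
  obtain ⟨a, ha, b, hb, rfl⟩ := Submodule.mem_sup.1
    (hcompl.sup_eq_top ▸ Submodule.mem_top : x ∈ _ ⊔ _)
  have hfix : T a = a := (sub_eq_zero.1 ha).symm
  refine ⟨a + 0, ?_⟩
  simp only [map_add, cesaroMean_apply_of_fixed hβ0 hfix]
  exact tendsto_const_nhds.add (tendsto_cesaroMean_closure_range hσ hβ0 hC' hb)
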